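/- All Hilbert spaces are finite-dimensional and $\log$ is the natural logarithm. Let $H_s=\sum_i\epsilon_i|\epsilon_i\rangle\langle\epsilon_i|$ and $H_b=\sum_kE_k|E_k\rangle\langle E_k|$ be Hamiltonians of a battery $s$ and a bath $b\neq 0$ (orthonormal eigenbases), let $\beta>0$, $Z=\sum_ke^{-\beta E_k}$, $\tau^b_\beta=Z^{-1}\sum_ke^{-\beta E_k}|E_k\rangle\langle E_k|$, and let $U_{sb}$ be a unitary with $[U_{sb},H_s\otimes I_b+I_s\otimes H_b]=0$. These data give the thermal operation $\Lambda_\beta(\rho_s)=\operatorname{Tr}_b[U_{sb}(\rho_s\otimes\tau^b_\beta)U_{sb}^\dagger]$. Let $R$ be a copy of $b$, $|\phi^+_\beta\rangle_{bR}=Z^{-1/2}\sum_ke^{-\beta E_k/2}|E_k\rangle_b\otimes|E_k\rangle_R$, and for a density operator $\rho_s$ put $$\sigma_{sbR}=(U_{sb}\otimes I_R)(\rho_s\otimes|\phi^+_\beta\rangle\langle\phi^+_\beta|_{bR})(U_{sb}^\dagger\otimes I_R),\qquad \sigma_{sR}=\operatorname{Tr}_b\sigma_{sbR},\qquad \sigma_s=\Lambda_\beta(\rho_s).$$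 Let $S(\rho)=-\operatorname{Tr}(\rho\log\rho)$ and $F_\beta(\rho)=\operatorname{Tr}(H_s\rho)-\frac1\beta S(\rho)$. For a finite POVM $\{\Pi_b^k\}_k$ on $b$ let $p_k=\operatorname{Tr}[(I_s\otimes\Pi_b^k)\operatorname{Tr}_R\sigma_{sbR}]$ and $\sigma_{s|k}=\frac1{p_k}\operatorname{Tr}_b[(I_s\otimes\Pi_b^k)\operatorname{Tr}_R\sigma_{sbR}]$ (outcomes with $p_k=0$ contribute nothing), and let $$W_{weak}(\rho_s,\Lambda_\beta)=\max_{\{\Pi_b^k\}}\sum_kp_kF_\beta(\sigma_{s|k}).$$ For a bipartite state $\rho_{AB}$ let $E_f(\rho_{AB})=\min\sum_ip_iS(\operatorname{Tr}_B|\psi_i\rangle\langle\psi_i|)$ be the entanglement of formation, with the minimum over all finite decompositions $\rho_{AB}=\sum_ip_i|\psi_i\rangle\langle\psi_i|$ into unit vectors with probabilities $p_i$. Theorem. For every battery state $\rho_s$ and every such thermal operation $\Lambda_\beta$, the maximum defining $W_{weak}(\rho_s,\Lambda_\beta)$ and the minimum defining $E_f(\sigma_{sR})$ are attained, and $$W_{weak}(\rho_s,\Lambda_\beta)\le\operatorname{Tr}(\sigma_sH_s)-\frac1\beta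 E_f(\sigma_{sR}).$$ Equality holds whenever $\rho_s$ is pure. -/

import Mathlib

open Matrix
open scoped Kronecker ComplexOrder

noncomputable section

namespace QBattery

/-- The rank-one operator `|ψ⟩⟨ψ|` of a vector `ψ`. -/
def ketbra {n : Type*} (ψ : n → ℂ) : Matrix n n ℂ := vecMulVec ψ (star ψ)

/-- Density operators: positive semidefinite with unit trace. -/
def IsDensity {n : Type*} [Fintype n] (ρ : Matrix n n ℂ) : Prop :=
  ρ.PosSemidef ∧ ρ.trace = 1

/-- Pure states: `ρ = |ψ⟩⟨ψ|` for a unit vector `ψ`. -/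
def IsPure {n : Type*} [Fintype n] (ρ : Matrix n n ℂ) : Prop :=
  ∃ ψ : n → ℂ, star ψ ⬝ᵥ ψ = 1 ∧ ρ = ketbra ψ

/-- Partial trace over the second tensor factor. -/
def traceRight {m n : Type*} [Fintype n] (M : Matrix (m × n) (m × n) ℂ) : Matrix m m ℂ :=
  Matrix.of fun i j => ∑ k, M (i, k) (j, k)

/-- Partial trace over the middle factor of a tripartite system. -/
def traceMiddle {l m n : Type*} [Fintype m]
    (M : Matrix ((l × m) × n) ((l × m) × n) ℂ) : Matrix (l × n) (l × n) ℂ :=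
  Matrix.of fun i j => ∑ k, M ((i.1, k), i.2) ((j.1, k), j.2)

/-- Von Neumann entropy `S(ρ) = -Tr(ρ log ρ)`; natural logarithm, `0 log 0 = 0`. The logarithm of
the matrix is taken by the functional calculus of Hermitian matrices. -/
def entropy {n : Type*} [Fintype n] [DecidableEq n] (ρ : Matrix n n ℂ) : ℝ :=
  -(ρ * cfc Real.log ρ).trace.re

/-- A Hamiltonian in spectral form `H = ∑ k, E_k |E_k⟩⟨E_k|`: real energies and an orthonormal
eigenbasis. -/
structure Hamiltonian (n : Type*) [Fintype n] where
  energy : n → ℝ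
  eigenbasis : OrthonormalBasis n ℂ (EuclideanSpace ℂ n)

namespace Hamiltonian

variable {n : Type*} [Fintype n]

/-- The eigenvector `|E_k⟩`, in coordinates. -/
def eigenket (H : Hamiltonian n) (k : n) : n → ℂ := fun i => H.eigenbasis k i

/-- The operator `∑ k, E_k |E_k⟩⟨E_k|`. -/
def op (H : Hamiltonian n) : Matrix n n ℂ := ∑ k, (H.energy k : ℂ) • ketbra (H.eigenket k)

/-- The partition function `Z = ∑ k, exp (-β E_k)`. -/
def partition (H : Hamiltonian n) (β : ℝ) : ℝ := ∑ k, Real.exp (-β * H.energy k)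

/-- The thermal state `∑ k, exp (-β E_k) |E_k⟩⟨E_k| / Z`. -/
def thermalState (H : Hamiltonian n) (β : ℝ) : Matrix n n ℂ :=
  ((H.partition β)⁻¹ : ℂ) • ∑ k, (Real.exp (-β * H.energy k) : ℂ) • ketbra (H.eigenket k)

/-- The purification `Z^(-1/2) ∑ k, exp (-β E_k / 2) |E_k⟩ ⊗ |E_k⟩` of the thermal state. -/
def thermalPurification (H : Hamiltonian n) (β : ℝ) : n × n → ℂ := fun x =>
  ((Real.sqrt (H.partition β))⁻¹ : ℂ) *
    ∑ k, (Real.exp (-β * H.energy k / 2) : ℂ) * (H.eigenket k x.1 * H.eigenket k x.2)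

end Hamiltonian

/-- Free energy `F_β(ρ) = Tr(H ρ) - S(ρ) / β`. -/
def freeEnergy {n : Type*} [Fintype n] [DecidableEq n] (β : ℝ) (H ρ : Matrix n n ℂ) : ℝ :=
  (H * ρ).trace.re - 1 / β * entropy ρ

/-- A thermal operation on a system `s` with a bath `b`: an inverse temperature `β > 0`, system and
bath Hamiltonians, and a joint unitary that preserves the total energy. -/
structure ThermalOperation (s b : Type*) [Fintype s] [DecidableEq s] [Fintype b]
    [DecidableEq b] where
  β : ℝ
  β_pos : 0 < β
  Hs : Hamiltonian s
  Hb : Hamiltonian b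
  U : Matrix (s × b) (s × b) ℂ
  unitary : U ∈ Matrix.unitaryGroup (s × b) ℂ
  energy_preserving : Commute U (Hs.op ⊗ₖ (1 : Matrix b b ℂ) + (1 : Matrix s s ℂ) ⊗ₖ Hb.op)

/-- A measurement (POVM) with `N` outcomes. -/
structure POVM (N : ℕ) (b : Type*) [Fintype b] [DecidableEq b] where
  effect : Fin N → Matrix b b ℂ
  posSemidef : ∀ k, (effect k).PosSemidef
  sum_eq_one : ∑ k, effect k = 1

namespace ThermalOperation

variable {s b : Type*} [Fintype s] [DecidableEq s] [Fintype b] [DecidableEq b]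

/-- The channel `ρ ↦ Tr_b [U (ρ ⊗ τ) U†]`, with `τ` the thermal state of the bath. -/
def apply (T : ThermalOperation s b) (ρ : Matrix s s ℂ) : Matrix s s ℂ :=
  traceRight (T.U * (ρ ⊗ₖ T.Hb.thermalState T.β) * T.Uᴴ)

/-- The joint state of system, bath and reference `R` (a copy of the bath), after the interaction:
`(U ⊗ 1_R) (ρ ⊗ |φ⟩⟨φ|_{bR}) (U ⊗ 1_R)†`. -/
def jointState (T : ThermalOperation s b) (ρ : Matrix s s ℂ) :
    Matrix ((s × b) × b) ((s × b) × b) ℂ :=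
  (T.U ⊗ₖ (1 : Matrix b b ℂ)) *
    (ρ ⊗ₖ ketbra (T.Hb.thermalPurification T.β)).submatrix
      (Equiv.prodAssoc s b b) (Equiv.prodAssoc s b b) *
    (T.U ⊗ₖ (1 : Matrix b b ℂ))ᴴ

/-- The battery-reference marginal `Tr_b` of the joint state. -/
def systemReference (T : ThermalOperation s b) (ρ : Matrix s s ℂ) :
    Matrix (s × b) (s × b) ℂ :=
  traceMiddle (T.jointState ρ)

/-- The probability `Tr[(1 ⊗ Π_k) Tr_R σ]` of outcome `k`. -/
def outcomeProb (T : ThermalOperation s b) (ρ : Matrix s s ℂ) {N : ℕ} (P : POVM N b)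
    (k : Fin N) : ℝ :=
  (((1 : Matrix s s ℂ) ⊗ₖ P.effect k) * traceRight (T.jointState ρ)).trace.re

/-- The battery state `Tr_b[(1 ⊗ Π_k) Tr_R σ] / p_k` conditioned on outcome `k`. -/
def postState (T : ThermalOperation s b) (ρ : Matrix s s ℂ) {N : ℕ} (P : POVM N b)
    (k : Fin N) : Matrix s s ℂ :=
  ((T.outcomeProb ρ P k)⁻¹ : ℂ) •
    traceRight (((1 : Matrix s s ℂ) ⊗ₖ P.effect k) * traceRight (T.jointState ρ))

/-- The charge retrieved with a given measurement of the bath: `∑ k, p_k F_β(σ_{s|k})`. -/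
def charge (T : ThermalOperation s b) (ρ : Matrix s s ℂ) {N : ℕ} (P : POVM N b) : ℝ :=
  ∑ k, T.outcomeProb ρ P k * freeEnergy T.β T.Hs.op (T.postState ρ P k)

/-- All the charges that measurements of the bath can retrieve. -/
def weakCharges (T : ThermalOperation s b) (ρ : Matrix s s ℂ) : Set ℝ :=
  {w | ∃ (N : ℕ) (P : POVM N b), w = T.charge ρ P}

/-- The optimal charge under weak assistance, `max` over all measurements of the bath. -/
def weakCharge (T : ThermalOperation s b) (ρ : Matrix s s ℂ) : ℝ := sSup (T.weakCharges ρ)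

end ThermalOperation

/-- The average entanglement entropies `∑ i, p_i S(Tr_B |ψ_i⟩⟨ψ_i|)` of the finite pure-state
decompositions `ρ = ∑ i, p_i |ψ_i⟩⟨ψ_i|` of a bipartite state. -/
def ensembleEntanglements {m n : Type*} [Fintype m] [DecidableEq m] [Fintype n]
    (ρ : Matrix (m × n) (m × n) ℂ) : Set ℝ :=
  {e | ∃ (N : ℕ) (p : Fin N → ℝ) (ψ : Fin N → m × n → ℂ),
    (∀ i, 0 ≤ p i) ∧ ∑ i, p i = 1 ∧ (∀ i, star (ψ i) ⬝ᵥ ψ i = 1) ∧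
    ρ = ∑ i, (p i : ℂ) • ketbra (ψ i) ∧
    e = ∑ i, p i * entropy (traceRight (ketbra (ψ i)))}

/-- Entanglement of formation: the `min` over all pure-state decompositions. -/
def entanglementOfFormation {m n : Type*} [Fintype m] [DecidableEq m] [Fintype n]
    (ρ : Matrix (m × n) (m × n) ℂ) : ℝ :=
  sInf (ensembleEntanglements ρ)

end QBattery

end

/-! The energy part of the charge is linear in the conditional states, so it averages to `Tr(σ_s
H_s)` whatever the measurement. Maximizing the charge therefore means minimizing the average entropy
left in the battery by a measurement of the bath (`charge_eq`), and that minimum has to be compared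
with `E_f(σ_sR)`.

Bound: split `σ_sbR` into rank-one terms and every effect into rank-one effects `|w⟩⟨w|`. The
contractions `⟨w|Ψ⟩` are vectors on `sR` that decompose `σ_sR`, and their `s`-marginals add up to
the conditional battery states. By concavity of the entropy, the measurement leaves at least the
average entropy of this decomposition (`exists_ensembleEntanglement_le_measuredEntropy`).

Equality: if `ρ_s` is pure, so is `σ_sbR`. Every pure decomposition of `σ_sR` can then be steered by
measuring the purifying system `b` (`exists_povm_measuredEntropy_eq`), in particular an optimal one.

Attainment: with an unbounded number of terms, both sets of averages are slices of the convex hull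
of a compact set in finite dimension, hence compact by Carathéodory (`isCompact_ensemble_values`).

Weights are absorbed into unnormalized operators; `scaledEntropy` is homogeneous of degree one and
superadditive, so no probability need be divided out. -/

noncomputable section

namespace QBattery

/-! ### Compactness of convex hulls and of sets of ensemble averages -/

/-- In finite dimension, the convex hull of a compact set is compact. -/
theorem isCompact_convexHull_of_isCompact {E : Type*} [AddCommGroup E] [Module ℝ E]
    [TopologicalSpace E] [IsTopologicalAddGroup E] [ContinuousSMul ℝ E] [FiniteDimensional ℝ E]
    {K : Set E} (hK : IsCompact K) : IsCompact (convexHull ℝ K) := by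
  rcases K.eq_empty_or_nonempty with rfl | ⟨x₀, hx₀⟩
  · simp
  -- Carathéodory: `D` points always suffice. Shorter combinations are padded with `x₀` at weight
  -- zero, so the hull is a continuous image of simplex times `K ^ D`.
  set D := Module.finrank ℝ E + 1
  have himage : convexHull ℝ K = (fun q : (Fin D → ℝ) × (Fin D → E) => ∑ i, q.1 i • q.2 i) ''
      (stdSimplex ℝ (Fin D) ×ˢ Set.univ.pi fun _ => K) := by
    apply Set.Subset.antisymm
    · intro x hx
      obtain ⟨ι, _, z, w, hzK, hind, hw, hw1, rfl⟩ := eq_pos_convex_span_of_mem_convexHull hx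
      have hcard : Fintype.card ι ≤ Fintype.card (Fin D) := by
        simpa [D] using hind.card_le_finrank_succ.trans
          (Nat.add_le_add_right (Submodule.finrank_le _) 1)
      obtain ⟨j⟩ := Function.Embedding.nonempty_of_card_le hcard
      refine ⟨(Function.extend j w 0, Function.extend j z fun _ => x₀), ⟨⟨?_, ?_⟩, ?_⟩, ?_⟩
      · intro k
        by_cases hk : ∃ i, j i = k
        · obtain ⟨i, rfl⟩ := hk
          simpa [j.injective.extend_apply] using (hw i).le
        · simp [Function.extend_apply' _ _ _ hk]
      · rw [← hw1]
        refine (Fintype.sum_of_injective j j.injective _ _ (fun k hk => ?_) fun i => ?_).symm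
        · simp [Function.extend_apply' _ _ _ (show ¬ ∃ i, j i = k by simpa using hk)]
        · simp [j.injective.extend_apply]
      · intro k _
        by_cases hk : ∃ i, j i = k
        · obtain ⟨i, rfl⟩ := hk
          simpa [j.injective.extend_apply] using hzK ⟨i, rfl⟩
        · simpa [Function.extend_apply' _ _ _ hk] using hx₀
      · refine (Fintype.sum_of_injective j j.injective _ _ (fun k hk => ?_) fun i => ?_).symm
        · simp [Function.extend_apply' _ _ _ (show ¬ ∃ i, j i = k by simpa using hk)]
        · simp [j.injective.extend_apply]
    · rintro _ ⟨⟨w, z⟩, ⟨hw, hz⟩, rfl⟩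
      exact mem_convexHull_of_exists_fintype w z hw.1 hw.2 (fun i => hz i trivial) rfl
  rw [himage]
  refine ((isCompact_stdSimplex ℝ (Fin D)).prod (isCompact_univ_pi fun _ => hK)).image ?_
  fun_prop

/-- The values `∑ i, t i * f (x i)` over all finite families of points of a compact set with
nonnegative weights of total mass `c` and prescribed barycentre form a compact set. -/
theorem isCompact_ensemble_values {X E : Type*} [TopologicalSpace X] [AddCommGroup E] [Module ℝ E]
    [TopologicalSpace E] [IsTopologicalAddGroup E] [ContinuousSMul ℝ E] [FiniteDimensional ℝ E]
    [T2Space E] {K : Set X} (hK : IsCompact K) {F : X → E} {f : X → ℝ} (hF : ContinuousOn F K)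
    (hf : ContinuousOn f K) (y : E) {c : ℝ} (hc : 0 < c) :
    IsCompact {e : ℝ | ∃ (N : ℕ) (t : Fin N → ℝ) (x : Fin N → X), (∀ i, 0 ≤ t i) ∧
      (∀ i, x i ∈ K) ∧ ∑ i, t i = c ∧ ∑ i, t i • F (x i) = y ∧ e = ∑ i, t i * f (x i)} := by
  have hH := isCompact_convexHull_of_isCompact (hK.image_of_continuousOn (hF.prodMk hf))
  -- After division by `c`, an ensemble is a convex combination of points `(F x, f x)`. Fixing the
  -- barycentre cuts the hull along a closed fibre of the first coordinate.
  have himage : {e : ℝ | ∃ (N : ℕ) (t : Fin N → ℝ) (x : Fin N → X), (∀ i, 0 ≤ t i) ∧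
      (∀ i, x i ∈ K) ∧ ∑ i, t i = c ∧ ∑ i, t i • F (x i) = y ∧ e = ∑ i, t i * f (x i)} =
      (fun q : E × ℝ => c * q.2) '' (convexHull ℝ ((fun x => (F x, f x)) '' K) ∩
        Prod.fst ⁻¹' {c⁻¹ • y}) := by
    ext e
    constructor
    · rintro ⟨N, t, x, ht, hx, hsum, rfl, rfl⟩
      refine ⟨∑ i, (c⁻¹ * t i) • (F (x i), f (x i)), ⟨?_, ?_⟩, ?_⟩
      · refine mem_convexHull_of_exists_fintype (fun i => c⁻¹ * t i) (fun i => (F (x i), f (x i)))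
          (fun i => mul_nonneg (inv_nonneg.2 hc.le) (ht i)) ?_ (fun i => ⟨x i, hx i, rfl⟩) rfl
        rw [← Finset.mul_sum, hsum, inv_mul_cancel₀ hc.ne']
      · simp [Prod.fst_sum, Finset.smul_sum, mul_smul]
      · simp only [Prod.snd_sum, Prod.smul_snd, smul_eq_mul, Finset.mul_sum]
        refine Finset.sum_congr rfl fun i _ => ?_
        field_simp
    · rintro ⟨⟨_, e'⟩, ⟨hq, rfl⟩, rfl⟩
      obtain ⟨ι, _, w, z, hw, hw1, hz, hwz⟩ := mem_convexHull_iff_exists_fintype.1 hq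
      choose x hxK hxz using hz
      have h1 : ∑ i, w i • F (x i) = c⁻¹ • y := by
        have := congrArg Prod.fst hwz
        simpa [Prod.fst_sum, ← hxz] using this
      have h2 : ∑ i, w i * f (x i) = e' := by
        have := congrArg Prod.snd hwz
        simpa [Prod.snd_sum, ← hxz] using this
      let r := (Fintype.equivFin ι).symm
      refine ⟨Fintype.card ι, fun i => c * w (r i), fun i => x (r i),
        fun i => mul_nonneg hc.le (hw _), fun i => hxK _, ?_, ?_, ?_⟩
      · rw [r.sum_comp fun i => c * w i, ← Finset.mul_sum, hw1, mul_one]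
      · rw [r.sum_comp fun i => (c * w i) • F (x i)]
        simp_rw [mul_smul, ← Finset.smul_sum, h1, smul_smul, mul_inv_cancel₀ hc.ne', one_smul]
      · rw [r.sum_comp fun i => (c * w i) * f (x i)]
        simp_rw [mul_assoc, ← Finset.mul_sum, h2]
  rw [himage]
  exact (hH.inter_right (isClosed_singleton.preimage continuous_fst)).image (by fun_prop)

/-! ### Von Neumann entropy: continuity, homogeneity, concavity -/

section entropy

variable {n : Type*} [Fintype n] [DecidableEq n]

theorem continuousOn_spectrum_matrix (f : ℝ → ℝ) (A : Matrix n n ℂ) :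
    ContinuousOn f (spectrum ℝ A) :=
  A.finite_real_spectrum.continuousOn f

/-- Replaces `log`, discontinuous at `0`, by the continuous function `-x log x`; continuity in the
matrix then follows from that of the functional calculus. -/
theorem entropy_eq_trace_cfc {M : Matrix n n ℂ} (hM : M.IsHermitian) :
    entropy M = (cfc Real.negMulLog M).trace.re := by
  have hsa : IsSelfAdjoint M := hM
  have h : cfc Real.negMulLog M = -(M * cfc Real.log M) := by
    rw [Real.negMulLog_eq_neg, cfc_neg,
      cfc_mul (fun x => x) Real.log M (continuousOn_spectrum_matrix _ _)
        (continuousOn_spectrum_matrix _ _), cfc_id' ℝ M]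
  rw [h, entropy, trace_neg, Complex.neg_re]

theorem entropy_eq_sum_eigenvalues {M : Matrix n n ℂ} (hM : M.IsHermitian) :
    entropy M = ∑ i, Real.negMulLog (hM.eigenvalues i) := by
  rw [entropy_eq_trace_cfc hM, hM.cfc_eq, IsHermitian.cfc, Unitary.conjStarAlgAut_apply,
    trace_mul_comm, ← mul_assoc]
  simp [trace_diagonal]

theorem continuous_entropy_comp {X : Type*} [TopologicalSpace X] {a : X → Matrix n n ℂ}
    (ha : Continuous a) (hherm : ∀ x, (a x).IsHermitian) : Continuous fun x => entropy (a x) := by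
  have hcont : Continuous fun x => cfc Real.negMulLog (a x) := by
    open scoped Matrix.Norms.L2Operator in
    exact Continuous.cfc_of_mem_nhdsSet (s := Set.univ) (p := IsSelfAdjoint) Real.negMulLog
      Filter.univ_mem ha hherm Real.continuous_negMulLog.continuousOn
  simp_rw [fun x => entropy_eq_trace_cfc (hherm x)]
  exact Complex.continuous_re.comp hcont.matrix_trace

theorem entropy_smul {M : Matrix n n ℂ} (hM : M.IsHermitian) (c : ℝ) :
    entropy ((c : ℂ) • M) = c * entropy M + M.trace.re * Real.negMulLog c := by
  have hsa : IsSelfAdjoint M := hM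
  have hcM : ((c : ℂ) • M).IsHermitian := by
    simp [IsHermitian, conjTranspose_smul, hM.eq]
  rw [entropy_eq_trace_cfc hcM, entropy_eq_trace_cfc hM, Complex.coe_smul,
    ← cfc_comp_const_mul c Real.negMulLog M
      ((finite_real_spectrum (A := M)).image _ |>.continuousOn _)]
  have h : (fun x => Real.negMulLog (c * x)) =
      fun x => c * Real.negMulLog x + Real.negMulLog c * x := by
    funext x
    rw [Real.negMulLog_mul]
    ring
  rw [h, cfc_add _ _ _ (continuousOn_spectrum_matrix _ _) (continuousOn_spectrum_matrix _ _),
    cfc_const_mul _ _ _ (continuousOn_spectrum_matrix _ _), cfc_const_mul_id _ M]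
  simp [trace_add, trace_smul]
  ring

/-- In any orthonormal basis, the Shannon entropy of the diagonal dominates the von Neumann
entropy. -/
theorem entropy_le_sum_negMulLog_diag {A : Matrix n n ℂ} (hA : A.PosSemidef)
    {V : Matrix n n ℂ} (hV : V ∈ unitaryGroup n ℂ) :
    entropy A ≤ ∑ i, Real.negMulLog ((star V * A * V) i i).re := by
  set a := hA.1.eigenvalues
  obtain ⟨Q, hQ, h⟩ : ∃ Q ∈ unitaryGroup n ℂ,
      star V * A * V = Q * diagonal (fun j => (a j : ℂ)) * star Q := by
    refine ⟨star V * hA.1.eigenvectorUnitary,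
      mul_mem (Unitary.star_mem hV) (SetLike.coe_mem _), ?_⟩
    conv_lhs => rw [hA.1.spectral_theorem, Unitary.conjStarAlgAut_apply]
    simp only [star_mul, star_star, mul_assoc]
    rfl
  -- The diagonal is the image of the spectrum under the doubly stochastic matrix `|Q i j|²`;
  -- Jensen's inequality on each row does the rest.
  have hdiag : ∀ i, ((star V * A * V) i i).re = ∑ j, Complex.normSq (Q i j) * a j := by
    intro i
    rw [h, mul_apply, Complex.re_sum]
    refine Finset.sum_congr rfl fun j _ => ?_
    rw [mul_diagonal, star_apply, mul_right_comm, RCLike.star_def, Complex.mul_conj]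
    simp
  have hrow : ∀ i, ∑ j, Complex.normSq (Q i j) = 1 := by
    intro i
    have h := congrFun (congrFun (mem_unitaryGroup_iff.1 hQ) i) i
    rw [mul_apply, one_apply_eq] at h
    simp only [star_apply, RCLike.star_def, Complex.mul_conj] at h
    exact_mod_cast h
  have hcol : ∀ j, ∑ i, Complex.normSq (Q i j) = 1 := by
    intro j
    have h := congrFun (congrFun (mem_unitaryGroup_iff'.1 hQ) j) j
    rw [mul_apply, one_apply_eq] at h
    simp only [star_apply, RCLike.star_def, mul_comm (starRingEnd ℂ _), Complex.mul_conj] at h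
    exact_mod_cast h
  calc entropy A = ∑ j, Real.negMulLog (a j) := entropy_eq_sum_eigenvalues hA.1
    _ = ∑ j, ∑ i, Complex.normSq (Q i j) * Real.negMulLog (a j) := by
        simp_rw [← Finset.sum_mul, hcol, one_mul]
    _ = ∑ i, ∑ j, Complex.normSq (Q i j) * Real.negMulLog (a j) :=
        Finset.sum_comm
    _ ≤ _ := by
        refine Finset.sum_le_sum fun i _ => ?_
        rw [hdiag]
        exact Real.concaveOn_negMulLog.le_map_sum (fun j _ => Complex.normSq_nonneg _) (hrow i)
          fun j _ => hA.eigenvalues_nonneg j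

theorem entropy_eq_sum_negMulLog_diag {A : Matrix n n ℂ} (hA : A.IsHermitian) :
    entropy A = ∑ i, Real.negMulLog
      ((star (hA.eigenvectorUnitary : Matrix n n ℂ) * A * hA.eigenvectorUnitary) i i).re := by
  rw [entropy_eq_sum_eigenvalues hA]
  refine Finset.sum_congr rfl fun i _ => ?_
  have h : star (hA.eigenvectorUnitary : Matrix n n ℂ) * A * hA.eigenvectorUnitary =
      diagonal fun j => (hA.eigenvalues j : ℂ) := by
    conv_lhs =>
      enter [1, 2]
      rw [hA.spectral_theorem, Unitary.conjStarAlgAut_apply]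
    simp only [mul_assoc, Unitary.coe_star_mul_self, mul_one]
    rw [← mul_assoc, Unitary.coe_star_mul_self, one_mul]
    rfl
  rw [h, diagonal_apply_eq, Complex.ofReal_re]

/-- Each summand is the perspective `U η(u / U)` of the concave function `η(u) = -u log u`, and
perspectives of concave functions are superadditive. -/
theorem negMulLog_perspective_superadditive {x y X Y : ℝ} (hx : 0 ≤ x) (hy : 0 ≤ y) (hxX : x ≤ X)
    (hyY : y ≤ Y) :
    (Real.negMulLog x + x * Real.log X) + (Real.negMulLog y + y * Real.log Y) ≤
      Real.negMulLog (x + y) + (x + y) * Real.log (X + Y) := by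
  rcases (hx.trans hxX).eq_or_lt with hX | hX
  · obtain rfl : x = 0 := le_antisymm (hX ▸ hxX) hx
    simp [← hX]
  rcases (hy.trans hyY).eq_or_lt with hY | hY
  · obtain rfl : y = 0 := le_antisymm (hY ▸ hyY) hy
    simp [← hY]
  have key : ∀ {u U : ℝ}, 0 < U → U * Real.negMulLog (u / U) =
      Real.negMulLog u + u * Real.log U := by
    intro u U hU
    rw [div_eq_mul_inv, Real.negMulLog_mul]
    simp only [Real.negMulLog, Real.log_inv]
    field_simp
  have hXY : 0 < X + Y := add_pos hX hY
  rw [← key hX, ← key hY, ← key hXY]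
  have h := Real.concaveOn_negMulLog.2 (x := x / X) (y := y / Y) (div_nonneg hx hX.le)
    (div_nonneg hy hY.le) (div_nonneg hX.le hXY.le) (div_nonneg hY.le hXY.le)
    (by rw [← add_div, div_self hXY.ne'])
  simp only [smul_eq_mul] at h
  have harg : X / (X + Y) * (x / X) + Y / (X + Y) * (y / Y) = (x + y) / (X + Y) := by
    field_simp
  rw [harg] at h
  have := mul_le_mul_of_nonneg_left h hXY.le
  refine le_trans (le_of_eq ?_) this
  field_simp

/-- Concavity of the Shannon entropy without normalization: the perspective inequality, summed with
`X` and `Y` the total masses. -/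
theorem shannon_superadditive {ι : Type*} [Fintype ι] {x y : ι → ℝ} (hx : ∀ i, 0 ≤ x i)
    (hy : ∀ i, 0 ≤ y i) :
    (∑ i, Real.negMulLog (x i) - Real.negMulLog (∑ i, x i)) +
      (∑ i, Real.negMulLog (y i) - Real.negMulLog (∑ i, y i)) ≤
      ∑ i, Real.negMulLog (x i + y i) - Real.negMulLog (∑ i, (x i + y i)) := by
  have h := Finset.sum_le_sum fun i (_ : i ∈ Finset.univ) =>
    negMulLog_perspective_superadditive (hx i) (hy i)
      (Finset.single_le_sum (fun j _ => hx j) (Finset.mem_univ i))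
      (Finset.single_le_sum (fun j _ => hy j) (Finset.mem_univ i))
  simp only [Finset.sum_add_distrib, ← Finset.sum_mul] at h
  simp only [Finset.sum_add_distrib]
  rw [Real.negMulLog_def]
  rw [Real.negMulLog_def] at h
  simp only at h ⊢
  linarith

/-- The entropy of the normalized operator, weighted by the trace. -/
def scaledEntropy (M : Matrix n n ℂ) : ℝ :=
  M.trace.re * entropy (((M.trace.re : ℂ)⁻¹) • M)

theorem scaledEntropy_zero : scaledEntropy (0 : Matrix n n ℂ) = 0 := by simp [scaledEntropy]

theorem scaledEntropy_smul (t : ℝ) (M : Matrix n n ℂ) :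
    scaledEntropy ((t : ℂ) • M) = t * scaledEntropy M := by
  rcases eq_or_ne t 0 with rfl | ht
  · simp [scaledEntropy]
  have h1 : ((t : ℂ) • M).trace.re = t * M.trace.re := by simp [trace_smul]
  have h2 : ((t : ℂ) * (M.trace.re : ℂ))⁻¹ * (t : ℂ) = (M.trace.re : ℂ)⁻¹ := by
    have : (t : ℂ) ≠ 0 := by exact_mod_cast ht
    field_simp
  rw [scaledEntropy, h1, Complex.ofReal_mul, smul_smul, h2, mul_assoc, scaledEntropy]

theorem eq_zero_of_trace_re_eq_zero {m : Type*} [Fintype m] {M : Matrix m m ℂ} (hM : M.PosSemidef)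
    (h : M.trace.re = 0) : M = 0 :=
  hM.trace_eq_zero_iff.1 (Complex.ext h (by
    have := hM.trace_nonneg
    exact (Complex.le_def.1 this).2.symm))

theorem scaledEntropy_eq {M : Matrix n n ℂ} (hM : M.PosSemidef) :
    scaledEntropy M = entropy M - Real.negMulLog M.trace.re := by
  rcases eq_or_ne M.trace.re 0 with h | h
  · rw [eq_zero_of_trace_re_eq_zero hM h]
    simp [scaledEntropy, entropy]
  · rw [scaledEntropy, ← Complex.ofReal_inv, entropy_smul hM.1]
    simp only [Real.negMulLog, Real.log_inv]
    field_simp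
    ring

theorem continuous_scaledEntropy_comp {X : Type*} [TopologicalSpace X] {a : X → Matrix n n ℂ}
    (ha : Continuous a) (hpsd : ∀ x, (a x).PosSemidef) :
    Continuous fun x => scaledEntropy (a x) := by
  simp_rw [fun x => scaledEntropy_eq (hpsd x)]
  exact (continuous_entropy_comp ha fun x => (hpsd x).1).sub
    (Real.continuous_negMulLog.comp (Complex.continuous_re.comp ha.matrix_trace))

/-- Concavity of the von Neumann entropy, in homogeneous form. -/
theorem scaledEntropy_add_le {A B : Matrix n n ℂ} (hA : A.PosSemidef) (hB : B.PosSemidef) :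
    scaledEntropy A + scaledEntropy B ≤ scaledEntropy (A + B) := by
  have hAB := hA.add hB
  -- In an eigenbasis of `A + B` the diagonal entropy is exact for the sum and only an upper bound
  -- for `A` and `B`, so the classical inequality transfers.
  set V := (hAB.1.eigenvectorUnitary : Matrix n n ℂ) with hVdef
  have hV : V ∈ unitaryGroup n ℂ := SetLike.coe_mem _
  have htr : ∀ M : Matrix n n ℂ, M.trace.re =
      ∑ i, ((star V * M * V) i i).re := by
    intro M
    rw [← Complex.re_sum]
    change _ = (star V * M * V).trace.re
    rw [trace_mul_comm, ← mul_assoc, mem_unitaryGroup_iff.1 hV, one_mul]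
  have hnn : ∀ {M : Matrix n n ℂ}, M.PosSemidef → ∀ i,
      0 ≤ ((star V * M * V) i i).re := by
    intro M hM i
    exact (Complex.le_def.1 ((hM.conjTranspose_mul_mul_same V).diag_nonneg
      (i := i))).1
  have hadd : ∀ i, ((star V * (A + B) * V) i i).re =
      ((star V * A * V) i i).re + ((star V * B * V) i i).re := by
    intro i
    rw [mul_add, add_mul, Matrix.add_apply, Complex.add_re]
  have h := shannon_superadditive (hnn hA) (hnn hB)
  have hS := entropy_eq_sum_negMulLog_diag hAB.1
  rw [scaledEntropy_eq hA, scaledEntropy_eq hB, scaledEntropy_eq hAB, hS, htr A, htr B, htr (A + B)]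
  simp only [← hVdef, hadd] at h ⊢
  have hSA := entropy_le_sum_negMulLog_diag hA hV
  have hSB := entropy_le_sum_negMulLog_diag hB hV
  linarith

theorem sum_scaledEntropy_le {ι : Type*} (I : Finset ι) {A : ι → Matrix n n ℂ}
    (hA : ∀ i, (A i).PosSemidef) :
    ∑ i ∈ I, scaledEntropy (A i) ≤ scaledEntropy (∑ i ∈ I, A i) := by
  classical
  induction I using Finset.induction_on with
  | empty => simp [scaledEntropy_zero]
  | insert i I hi ih =>
    rw [Finset.sum_insert hi, Finset.sum_insert hi]
    exact (add_le_add_right ih _).trans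
      (scaledEntropy_add_le (hA i) (posSemidef_sum _ fun j _ => hA j))

end entropy

/-! ### Rank-one operators and partial traces -/

theorem posSemidef_ketbra {n : Type*} [Fintype n] (ψ : n → ℂ) : (ketbra ψ).PosSemidef :=
  posSemidef_vecMulVec_self_star ψ

theorem exists_eq_sum_ketbra {n : Type*} [Fintype n] {M : Matrix n n ℂ} (hM : M.PosSemidef) :
    ∃ (m : ℕ) (v : Fin m → n → ℂ), M = ∑ i, ketbra (v i) :=
  posSemidef_iff_eq_sum_vecMulVec.1 hM

theorem trace_ketbra {n : Type*} [Fintype n] (ψ : n → ℂ) : (ketbra ψ).trace = star ψ ⬝ᵥ ψ := by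
  rw [ketbra, trace_vecMulVec, dotProduct_comm]

theorem ketbra_smul {n : Type*} (c : ℂ) (ψ : n → ℂ) :
    ketbra (c • ψ) = (c * star c) • ketbra ψ := by
  ext i j
  simp [ketbra, vecMulVec_apply]
  ring

section traces

variable {l m n : Type*}

theorem traceRight_sum [Fintype n] {ι : Type*} (I : Finset ι) (M : ι → Matrix (m × n) (m × n) ℂ) :
    traceRight (∑ i ∈ I, M i) = ∑ i ∈ I, traceRight (M i) := by
  ext i j
  simp only [traceRight, of_apply, Matrix.sum_apply]
  exact Finset.sum_comm

theorem traceRight_smul [Fintype n] (c : ℂ) (M : Matrix (m × n) (m × n) ℂ) :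
    traceRight (c • M) = c • traceRight M := by
  ext i j
  simp [traceRight, Finset.mul_sum]

theorem trace_traceRight [Fintype m] [Fintype n] (M : Matrix (m × n) (m × n) ℂ) :
    (traceRight M).trace = M.trace := by
  simp [traceRight, trace, Fintype.sum_prod_type]

theorem traceMiddle_sum [Fintype m] {ι : Type*} (I : Finset ι)
    (M : ι → Matrix ((l × m) × n) ((l × m) × n) ℂ) :
    traceMiddle (∑ i ∈ I, M i) = ∑ i ∈ I, traceMiddle (M i) := by
  ext i j
  simp only [traceMiddle, of_apply, Matrix.sum_apply]
  exact Finset.sum_comm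

theorem trace_traceMiddle [Fintype l] [Fintype m] [Fintype n]
    (M : Matrix ((l × m) × n) ((l × m) × n) ℂ) :
    (traceMiddle M).trace = M.trace := by
  simp only [traceMiddle, trace, diag_apply, of_apply, Fintype.sum_prod_type]
  exact Finset.sum_congr rfl fun _ _ => Finset.sum_comm

theorem posSemidef_traceRight [Fintype n] {M : Matrix (m × n) (m × n) ℂ} (hM : M.PosSemidef) :
    (traceRight M).PosSemidef := by
  have h : traceRight M = ∑ k, M.submatrix (fun i => (i, k)) (fun i => (i, k)) := by
    ext i j
    simp [traceRight, Matrix.sum_apply]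
  rw [h]
  exact posSemidef_sum _ fun k _ => hM.submatrix _

theorem continuous_traceRight [Fintype n] :
    Continuous (traceRight : Matrix (m × n) (m × n) ℂ → Matrix m m ℂ) := by
  refine continuous_matrix fun i j => ?_
  simp only [traceRight, of_apply]
  fun_prop

theorem continuous_ketbra : Continuous (ketbra : (n → ℂ) → Matrix n n ℂ) :=
  continuous_id.matrix_vecMulVec continuous_star

end traces

/-! ### Conditioning on an effect of the middle system -/

section conditioning

variable {s b r : Type*} [Fintype s] [DecidableEq s] [Fintype b] [Fintype r]

/-- The unnormalized state of the first system, conditioned on an effect `E` on the second. -/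
def condOp (E : Matrix b b ℂ) (σ : Matrix ((s × b) × r) ((s × b) × r) ℂ) : Matrix s s ℂ :=
  traceRight (((1 : Matrix s s ℂ) ⊗ₖ E) * traceRight σ)

/-- The contraction `⟨w|Ψ⟩` over the middle factor. -/
def slice (w : b → ℂ) (Ψ : (s × b) × r → ℂ) : s × r → ℂ :=
  fun x => ∑ l, star (w l) * Ψ ((x.1, l), x.2)

theorem condOp_apply (E : Matrix b b ℂ) (σ : Matrix ((s × b) × r) ((s × b) × r) ℂ) (i j : s) :
    condOp E σ i j = ∑ k, ∑ l, E k l * ∑ x, σ ((i, l), x) ((j, k), x) := by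
  simp [condOp, traceRight, mul_apply, Fintype.sum_prod_type, kroneckerMap_apply, one_apply,
    ite_mul, Finset.sum_ite_irrel]

theorem condOp_sum_left {ι : Type*} (I : Finset ι) (E : ι → Matrix b b ℂ)
    (σ : Matrix ((s × b) × r) ((s × b) × r) ℂ) :
    condOp (∑ i ∈ I, E i) σ = ∑ i ∈ I, condOp (E i) σ := by
  ext i j
  simp only [condOp_apply, Matrix.sum_apply, Finset.sum_mul]
  exact (Finset.sum_congr rfl fun k _ => Finset.sum_comm).trans Finset.sum_comm

theorem condOp_sum_right {ι : Type*} (I : Finset ι) (E : Matrix b b ℂ)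
    (σ : ι → Matrix ((s × b) × r) ((s × b) × r) ℂ) :
    condOp E (∑ i ∈ I, σ i) = ∑ i ∈ I, condOp E (σ i) := by
  rw [condOp, traceRight_sum, Finset.mul_sum, traceRight_sum]
  rfl

theorem condOp_smul_left (c : ℂ) (E : Matrix b b ℂ)
    (σ : Matrix ((s × b) × r) ((s × b) × r) ℂ) : condOp (c • E) σ = c • condOp E σ := by
  rw [condOp, kronecker_smul, smul_mul, traceRight_smul]
  rfl

theorem condOp_one [DecidableEq b] (σ : Matrix ((s × b) × r) ((s × b) × r) ℂ) :
    condOp 1 σ = traceRight (traceRight σ) := by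
  rw [condOp, one_kronecker_one, one_mul]

/-- The bridge between measurements and decompositions: a rank-one effect leaves a pure vector on
`sR`, whose marginal is the conditional state. -/
theorem condOp_ketbra (w : b → ℂ) (Ψ : (s × b) × r → ℂ) :
    condOp (ketbra w) (ketbra Ψ) = traceRight (ketbra (slice w Ψ)) := by
  ext i j
  simp only [condOp_apply, traceRight, of_apply, ketbra, vecMulVec_apply, slice, Pi.star_apply,
    star_sum, star_mul', star_star, Finset.sum_mul, Finset.mul_sum]
  rw [Finset.sum_comm (s := (Finset.univ : Finset r))]
  refine Finset.sum_congr rfl fun k _ => ?_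
  rw [Finset.sum_comm]
  refine Finset.sum_congr rfl fun x _ => Finset.sum_congr rfl fun l _ => ?_
  ring

theorem posSemidef_condOp {E : Matrix b b ℂ} (hE : E.PosSemidef)
    {σ : Matrix ((s × b) × r) ((s × b) × r) ℂ} (hσ : σ.PosSemidef) :
    (condOp E σ).PosSemidef := by
  obtain ⟨M, w, rfl⟩ := exists_eq_sum_ketbra hE
  obtain ⟨N, Ψ, rfl⟩ := exists_eq_sum_ketbra hσ
  rw [condOp_sum_left]
  refine posSemidef_sum _ fun i _ => ?_
  rw [condOp_sum_right]
  refine posSemidef_sum _ fun j _ => ?_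
  rw [condOp_ketbra]
  exact posSemidef_traceRight (posSemidef_ketbra _)

/-- The partial trace over `b` may be computed with any rank-one resolution of the identity in place
of a basis. -/
theorem sum_ketbra_slice {s b r ι : Type*} [Fintype b] [DecidableEq b] [Fintype ι] {w : ι → b → ℂ}
    (hw : ∑ i, ketbra (w i) = 1) (Ψ : (s × b) × r → ℂ) :
    ∑ i, ketbra (slice (w i) Ψ) = traceMiddle (ketbra Ψ) := by
  ext x y
  have h : ∀ k l, ∑ i, w i k * star (w i l) = if k = l then 1 else 0 := by
    intro k l
    have := congrFun (congrFun hw k) l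
    simpa [Matrix.sum_apply, ketbra, vecMulVec_apply, one_apply] using this
  calc (∑ i, ketbra (slice (w i) Ψ)) x y
      = ∑ k, ∑ l, (∑ i, w i k * star (w i l)) *
          (Ψ ((x.1, l), x.2) * star (Ψ ((y.1, k), y.2))) := by
        simp only [Matrix.sum_apply, ketbra, vecMulVec_apply, slice, Pi.star_apply,
          star_sum, star_mul', star_star, Finset.sum_mul, Finset.mul_sum]
        rw [Finset.sum_comm]
        refine Finset.sum_congr rfl fun k _ => ?_
        rw [Finset.sum_comm]
        refine Finset.sum_congr rfl fun l _ => Finset.sum_congr rfl fun i _ => ?_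
        ring
    _ = _ := by
        simp only [h, ite_mul, one_mul, zero_mul, Finset.sum_ite_eq, Finset.mem_univ, if_true]
        simp [traceMiddle, ketbra, vecMulVec_apply]

theorem continuous_condOp (σ : Matrix ((s × b) × r) ((s × b) × r) ℂ) :
    Continuous fun E : Matrix b b ℂ => condOp E σ := by
  refine continuous_matrix fun i j => ?_
  simp only [condOp_apply]
  fun_prop

end conditioning

/-! ### Pure-state ensembles and entanglement of formation -/

theorem isCompact_unit_vectors (n : Type*) [Fintype n] :
    IsCompact {ψ : n → ℂ | star ψ ⬝ᵥ ψ = 1} := by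
  refine (isCompact_closedBall (0 : n → ℂ) 1).of_isClosed_subset ?_ fun ψ hψ => ?_
  · refine isClosed_eq ?_ continuous_const
    exact continuous_star.dotProduct continuous_id
  · rw [mem_closedBall_zero_iff, pi_norm_le_iff_of_nonneg zero_le_one]
    intro i
    have h : ∑ j, ‖ψ j‖ ^ 2 = 1 := by
      have h1 : star ψ ⬝ᵥ ψ = 1 := hψ
      simp only [dotProduct, Pi.star_apply, RCLike.star_def, Complex.conj_mul'] at h1
      exact_mod_cast h1
    have := Finset.single_le_sum (fun j _ => sq_nonneg ‖ψ j‖) (Finset.mem_univ i)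
    exact (sq_le_one_iff₀ (norm_nonneg _)).1 (this.trans_eq h)

section formation

variable {m n : Type*} [Fintype m] [DecidableEq m] [Fintype n]

theorem isCompact_ensembleEntanglements (ρ : Matrix (m × n) (m × n) ℂ) :
    IsCompact (ensembleEntanglements ρ) := by
  have h := isCompact_ensemble_values (isCompact_unit_vectors (m × n))
    (F := ketbra) (f := fun ψ => entropy (traceRight (ketbra ψ))) continuous_ketbra.continuousOn
    (continuous_entropy_comp (continuous_traceRight.comp continuous_ketbra)
      fun ψ => (posSemidef_traceRight (posSemidef_ketbra ψ)).1).continuousOn ρ one_pos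
  convert h using 1
  ext e
  constructor
  · rintro ⟨N, p, ψ, h1, h2, h3, h4, h5⟩
    exact ⟨N, p, ψ, h1, h3, h2, by simpa using h4.symm, h5⟩
  · rintro ⟨N, p, ψ, h1, h3, h2, h4, h5⟩
    exact ⟨N, p, ψ, h1, h2, h3, by simpa using h4.symm, h5⟩

theorem star_dotProduct_self_eq_ofReal {n : Type*} [Fintype n] (ψ : n → ℂ) :
    star ψ ⬝ᵥ ψ = ((star ψ ⬝ᵥ ψ).re : ℂ) ∧ 0 ≤ (star ψ ⬝ᵥ ψ).re := by
  have h := Complex.le_def.1 (dotProduct_star_self_nonneg ψ)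
  exact ⟨Complex.ext rfl h.2.symm, h.1⟩

/-- Unnormalized ensembles also yield values of the average entanglement entropy. -/
theorem sum_scaledEntropy_mem_ensembleEntanglements {ι : Type*} [Fintype ι]
    {ρ : Matrix (m × n) (m × n) ℂ} (htr : ρ.trace = 1) {χ : ι → m × n → ℂ}
    (hχ : ρ = ∑ i, ketbra (χ i)) :
    ∑ i, scaledEntropy (traceRight (ketbra (χ i))) ∈ ensembleEntanglements ρ := by
  classical
  have hne : Nonempty (m × n) := by
    by_contra h
    rw [not_nonempty_iff] at h
    simp [trace] at htr
  set p : ι → ℝ := fun i => (star (χ i) ⬝ᵥ χ i).re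
  have hp : ∀ i, star (χ i) ⬝ᵥ χ i = (p i : ℂ) := fun i =>
    (star_dotProduct_self_eq_ofReal (χ i)).1
  have hp0 : ∀ i, 0 ≤ p i := fun i => (star_dotProduct_self_eq_ofReal (χ i)).2
  have hzero : ∀ i, p i = 0 → χ i = 0 := by
    intro i hi
    exact dotProduct_star_self_eq_zero.1 (by rw [hp, hi, Complex.ofReal_zero])
  have hψ : ∀ i, ∃ ψ : m × n → ℂ, star ψ ⬝ᵥ ψ = 1 ∧ (p i : ℂ) • ketbra ψ = ketbra (χ i) ∧
      (p i ≠ 0 → ketbra ψ = (p i : ℂ)⁻¹ • ketbra (χ i)) := by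
    intro i
    rcases eq_or_ne (p i) 0 with h | h
    -- A zero vector has no direction; any unit vector serves, since its weight is zero.
    · refine ⟨Pi.single hne.some 1, by simp, ?_, fun h' => absurd h h'⟩
      rw [hzero i h, h]
      simp [ketbra]
    · have hc : (p i : ℂ) ≠ 0 := by exact_mod_cast h
      have hs : ((Real.sqrt (p i) : ℂ))⁻¹ * star ((Real.sqrt (p i) : ℂ))⁻¹ = (p i : ℂ)⁻¹ := by
        rw [star_inv₀, RCLike.star_def, Complex.conj_ofReal, ← mul_inv, ← Complex.ofReal_mul,
          Real.mul_self_sqrt (hp0 i)]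
      have hk : ketbra (((Real.sqrt (p i) : ℂ))⁻¹ • χ i) = (p i : ℂ)⁻¹ • ketbra (χ i) := by
        rw [ketbra_smul, hs]
      refine ⟨((Real.sqrt (p i) : ℂ))⁻¹ • χ i, ?_, ?_, fun _ => hk⟩
      · rw [← trace_ketbra, hk, trace_smul, trace_ketbra, hp, smul_eq_mul, inv_mul_cancel₀ hc]
      · rw [hk, smul_smul, mul_inv_cancel₀ hc, one_smul]
  choose ψ hunit hket hket' using hψ
  let e := (Fintype.equivFin ι).symm
  refine ⟨Fintype.card ι, fun i => p (e i), fun i => ψ (e i), fun i => hp0 _, ?_,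
    fun i => hunit _, ?_, ?_⟩
  · rw [e.sum_comp p]
    rw [hχ, trace_sum] at htr
    simp only [trace_ketbra, hp] at htr
    exact_mod_cast htr
  · rw [e.sum_comp fun i => (p i : ℂ) • ketbra (ψ i), hχ]
    simp_rw [hket]
  · rw [e.sum_comp fun i => p i * entropy (traceRight (ketbra (ψ i)))]
    refine Finset.sum_congr rfl fun i _ => ?_
    have htr' : (traceRight (ketbra (χ i))).trace.re = p i := by
      rw [trace_traceRight, trace_ketbra]
    rw [scaledEntropy, htr']
    rcases eq_or_ne (p i) 0 with h | h
    · simp [h]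
    · rw [hket' i h, traceRight_smul]

end formation

/-! ### Measurements of the bath against pure-state decompositions -/

section measurement

variable {s b r : Type*} [Fintype s] [DecidableEq s] [Fintype b] [DecidableEq b] [Fintype r]

/-- The average entropy left in the first system by a measurement of the second. -/
def measuredEntropy (σ : Matrix ((s × b) × r) ((s × b) × r) ℂ) {N : ℕ} (P : POVM N b) : ℝ :=
  ∑ k, scaledEntropy (condOp (P.effect k) σ)

theorem exists_ensembleEntanglement_le_measuredEntropy
    {σ : Matrix ((s × b) × r) ((s × b) × r) ℂ} (hσ : σ.PosSemidef) (htr : σ.trace = 1) {N : ℕ}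
    (P : POVM N b) : ∃ e ∈ ensembleEntanglements (traceMiddle σ), e ≤ measuredEntropy σ P := by
  obtain ⟨M, Ψ, rfl⟩ := exists_eq_sum_ketbra hσ
  choose d w hw using fun k => exists_eq_sum_ketbra (P.posSemidef k)
  have hw1 : ∑ q : (k : Fin N) × Fin (d k), ketbra (w q.1 q.2) = 1 := by
    rw [Fintype.sum_sigma, ← P.sum_eq_one]
    exact Finset.sum_congr rfl fun k _ => (hw k).symm
  let χ : ((k : Fin N) × Fin (d k)) × Fin M → s × r → ℂ := fun q => slice (w q.1.1 q.1.2) (Ψ q.2)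
  refine ⟨∑ q, scaledEntropy (traceRight (ketbra (χ q))),
    sum_scaledEntropy_mem_ensembleEntanglements ?_ ?_, ?_⟩
  · rw [trace_traceMiddle, htr]
  · rw [Fintype.sum_prod_type_right, traceMiddle_sum]
    exact Finset.sum_congr rfl fun a _ => (sum_ketbra_slice hw1 (Ψ a)).symm
  · rw [Fintype.sum_prod_type, Fintype.sum_sigma, measuredEntropy]
    refine Finset.sum_le_sum fun k _ => ?_
    have hpsd : ∀ j a, (traceRight (ketbra (χ (⟨k, j⟩, a)))).PosSemidef := fun j a =>
      posSemidef_traceRight (posSemidef_ketbra _)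
    -- Concavity is used twice: to merge the rank-one parts of the state, then those of the effect.
    refine (Finset.sum_le_sum fun j _ => sum_scaledEntropy_le _ (hpsd j)).trans
      ((sum_scaledEntropy_le _ fun j => posSemidef_sum _ fun a _ => hpsd j a).trans
        (le_of_eq ?_))
    congr 1
    rw [hw k, condOp_sum_left]
    refine Finset.sum_congr rfl fun j _ => ?_
    rw [condOp_sum_right]
    exact Finset.sum_congr rfl fun a _ => (condOp_ketbra _ _).symm

/-- Two factorizations `A Aᴴ = X Xᴴ` differ by a contraction. -/
theorem exists_contraction_of_mul_conjTranspose_eq {m n p : Type*} [Fintype m] [DecidableEq m]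
    [Fintype n] [DecidableEq n] [Fintype p] {A : Matrix m n ℂ} {X : Matrix m p ℂ}
    (h : A * Aᴴ = X * Xᴴ) : ∃ V : Matrix n p ℂ, A * V = X ∧ (1 - V * Vᴴ).PosSemidef := by
  set K := A * Aᴴ with hK
  have hKh : K.IsHermitian := isHermitian_mul_conjTranspose_self A
  have hsa : IsSelfAdjoint K := hKh
  -- Since `0⁻¹ = 0`, this is the pseudo-inverse of `K`.
  set G := cfc (fun x : ℝ => x⁻¹) K with hG
  have hGh : Gᴴ = G := cfc_predicate (p := IsSelfAdjoint) (fun x : ℝ => x⁻¹) K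
  have c := fun f : ℝ → ℝ => continuousOn_spectrum_matrix f K
  have hid : cfc (fun x : ℝ => x) K = K := cfc_id' ℝ K
  have hKGK : K * G * K = K := by
    have : cfc (fun x : ℝ => x * x⁻¹ * x) K = K * G * K := by
      rw [cfc_mul _ _ K (c _) (c _), cfc_mul _ _ K (c _) (c _), hid]
    rw [← this]
    simp_rw [mul_inv_mul_cancel]
    exact hid
  have hGKG : G * K * G = G := by
    have : cfc (fun x : ℝ => x⁻¹ * x * x⁻¹) K = G * K * G := by
      rw [cfc_mul _ _ K (c _) (c _), cfc_mul _ _ K (c _) (c _), hid]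
    rw [← this, hG]
    congr 1
    funext x
    rcases eq_or_ne x 0 with rfl | hx
    · simp
    · field_simp
  -- `A V = K G X = X` because `X Xᴴ = K` is fixed by `K G`; and `V Vᴴ` is the orthogonal projection
  -- `Aᴴ G A`.
  refine ⟨Aᴴ * G * X, ?_, ?_⟩
  · have hz : (1 - K * G) * X = 0 := by
      apply self_mul_conjTranspose_eq_zero.1
      rw [conjTranspose_mul, Matrix.mul_assoc, ← Matrix.mul_assoc X, ← h,
        ← Matrix.mul_assoc, Matrix.sub_mul, Matrix.one_mul, hKGK,
        sub_self, Matrix.zero_mul]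
    rw [Matrix.sub_mul, Matrix.one_mul, sub_eq_zero] at hz
    rw [← Matrix.mul_assoc, ← Matrix.mul_assoc, ← hK, ← hz]
  · set Q := Aᴴ * G * A with hQ
    have hQh : Qᴴ = Q := by
      simp only [hQ, conjTranspose_mul, conjTranspose_conjTranspose, hGh, Matrix.mul_assoc]
    have hV : Aᴴ * G * X * (Aᴴ * G * X)ᴴ = Q := by
      calc Aᴴ * G * X * (Aᴴ * G * X)ᴴ = Aᴴ * (G * (X * Xᴴ) * G) * A := by
            simp only [conjTranspose_mul, conjTranspose_conjTranspose, hGh, Matrix.mul_assoc]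
        _ = Q := by rw [← h, hGKG]
    have hQQ : Q * Q = Q := by
      calc Q * Q = Aᴴ * (G * (A * Aᴴ) * G) * A := by simp only [hQ, Matrix.mul_assoc]
        _ = Q := by rw [← hK, hGKG]
    have hfac : 1 - Q = (1 - Q) * (1 - Q)ᴴ := by
      rw [conjTranspose_sub, conjTranspose_one, hQh, Matrix.mul_sub, Matrix.sub_mul,
        Matrix.sub_mul, Matrix.one_mul, Matrix.mul_one,
        Matrix.one_mul, hQQ, sub_self, sub_zero]
    rw [hV, hfac]
    exact posSemidef_self_mul_conjTranspose _

/-- Every decomposition of the marginal of a pure state is induced by a measurement of the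
complementary system. -/
theorem exists_povm_measuredEntropy_eq (Ψ : (s × b) × r → ℂ) {N : ℕ} {χ : Fin N → s × r → ℂ}
    (hχ : traceMiddle (ketbra Ψ) = ∑ i, ketbra (χ i)) :
    ∃ P : POVM (N + 1) b,
      measuredEntropy (ketbra Ψ) P = ∑ i, scaledEntropy (traceRight (ketbra (χ i))) := by
  classical
  obtain ⟨V, hV, hV1⟩ := exists_contraction_of_mul_conjTranspose_eq
    (A := Matrix.of fun (x : s × r) l => Ψ ((x.1, l), x.2)) (X := Matrix.of fun x i => χ i x) (by
      ext x y
      have := congrFun (congrFun hχ x) y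
      simpa [traceMiddle, ketbra, vecMulVec_apply, Matrix.sum_apply, mul_apply] using this)
  let w : Fin N → b → ℂ := fun i l => star (V l i)
  have hslice : ∀ i, slice (w i) Ψ = χ i := by
    intro i
    funext x
    have := congrFun (congrFun hV x) i
    simpa [slice, w, mul_apply, mul_comm] using this
  have hsum : ∑ i, ketbra (w i) = (V * Vᴴ)ᵀ := by
    ext k l
    simp [Matrix.sum_apply, ketbra, vecMulVec_apply, mul_apply, w, mul_comm]
  have hlast : (1 - ∑ i, ketbra (w i)).PosSemidef := by
    rw [hsum, ← transpose_one, ← transpose_sub]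
    exact hV1.transpose
  have hcond : ∀ i, condOp (ketbra (w i)) (ketbra Ψ) = traceRight (ketbra (χ i)) := by
    intro i
    rw [condOp_ketbra, hslice]
  -- The contraction only gives `∑ |w i⟩⟨w i| ≤ 1`, hence one extra outcome. The `χ i` already carry
  -- the whole trace, so that outcome has probability zero.
  have hzero : condOp (1 - ∑ i, ketbra (w i)) (ketbra Ψ) = 0 := by
    refine (posSemidef_condOp hlast (posSemidef_ketbra Ψ)).trace_eq_zero_iff.1 ?_
    have h1 : condOp (1 - ∑ i, ketbra (w i)) (ketbra Ψ) + ∑ i, traceRight (ketbra (χ i)) =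
        traceRight (traceRight (ketbra Ψ)) := by
      rw [← condOp_one, ← Finset.sum_congr rfl fun i _ => hcond i, ← condOp_sum_left]
      have := condOp_sum_left Finset.univ ![1 - ∑ i, ketbra (w i), ∑ i, ketbra (w i)] (ketbra Ψ)
      simp only [Fin.sum_univ_two, cons_val_zero, cons_val_one, sub_add_cancel] at this
      exact this.symm
    have h2 := congrArg trace h1
    rw [trace_add, trace_sum, trace_traceRight, trace_traceRight, ← trace_traceMiddle, hχ,
      trace_sum] at h2
    simpa [trace_traceRight] using h2
  refine ⟨⟨Fin.cons (1 - ∑ i, ketbra (w i)) fun i => ketbra (w i), ?_, ?_⟩, ?_⟩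
  · intro k
    refine Fin.cases ?_ (fun i => ?_) k
    · simpa using hlast
    · simpa using posSemidef_ketbra (w i)
  · rw [Fin.sum_univ_succ]
    simp
  · rw [measuredEntropy, Fin.sum_univ_succ]
    simp [hzero, hcond, scaledEntropy_zero]

theorem exists_povm_measuredEntropy_of_mem (Ψ : (s × b) × r → ℂ) {e : ℝ}
    (he : e ∈ ensembleEntanglements (traceMiddle (ketbra Ψ))) :
    ∃ (N : ℕ) (P : POVM N b), measuredEntropy (ketbra Ψ) P = e := by
  obtain ⟨N, p, ψ, hp, -, hψ, hdec, rfl⟩ := he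
  have hk : ∀ i, ketbra ((Real.sqrt (p i) : ℂ) • ψ i) = (p i : ℂ) • ketbra (ψ i) := by
    intro i
    rw [ketbra_smul, RCLike.star_def, Complex.conj_ofReal, ← Complex.ofReal_mul,
      Real.mul_self_sqrt (hp i)]
  obtain ⟨P, hP⟩ := exists_povm_measuredEntropy_eq Ψ (χ := fun i => (Real.sqrt (p i) : ℂ) • ψ i)
    (by rw [hdec]; exact Finset.sum_congr rfl fun i _ => (hk i).symm)
  refine ⟨N + 1, P, hP.trans (Finset.sum_congr rfl fun i _ => ?_)⟩
  rw [hk, traceRight_smul, scaledEntropy_smul, scaledEntropy, trace_traceRight, trace_ketbra, hψ]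
  simp

open scoped MatrixOrder in
theorem exists_eq_conjTranspose_mul_uncurry {M : Matrix b b ℂ} (hM : M.PosSemidef) :
    ∃ v : b × b → ℂ, M = (of fun i j => v (i, j))ᴴ * (of fun i j => v (i, j)) := by
  obtain ⟨B, hB⟩ := CStarAlgebra.nonneg_iff_eq_star_mul_self.1 hM.nonneg
  exact ⟨fun x => B x.1 x.2, hB⟩

theorem trace_conjTranspose_mul_uncurry {b : Type*} [Fintype b] (v : b × b → ℂ) :
    ((of fun i j => v (i, j))ᴴ * (of fun i j => v (i, j))).trace = star v ⬝ᵥ v := by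
  simp only [trace, diag_apply, mul_apply, conjTranspose_apply, of_apply, dotProduct,
    Fintype.sum_prod_type, Pi.star_apply]
  exact Finset.sum_comm

/-- A POVM is an ensemble of unit-trace effects weighted by their traces: total mass `card b`,
barycentre `1`. Writing such an effect as `Bᴴ B` turns its trace into the squared norm of `B`, so
unit vectors on `b × b` are a compact parameter space. -/
theorem isCompact_measuredEntropies [Nonempty b] {σ : Matrix ((s × b) × r) ((s × b) × r) ℂ}
    (hσ : σ.PosSemidef) :
    IsCompact {v : ℝ | ∃ (N : ℕ) (P : POVM N b), v = measuredEntropy σ P} := by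
  set F : (b × b → ℂ) → Matrix b b ℂ := fun v => (of fun i j => v (i, j))ᴴ * of fun i j => v (i, j)
  have hFc : Continuous F := by
    have : Continuous fun v : b × b → ℂ => (of fun i j => v (i, j) : Matrix b b ℂ) :=
      continuous_matrix fun i j => continuous_apply (i, j)
    exact this.matrix_conjTranspose.matrix_mul this
  have hFp : ∀ v, (F v).PosSemidef := fun v => posSemidef_conjTranspose_mul_self _
  have h := isCompact_ensemble_values (isCompact_unit_vectors (b × b)) (F := F)
    (f := fun v => scaledEntropy (condOp (F v) σ)) hFc.continuousOn
    (continuous_scaledEntropy_comp ((continuous_condOp σ).comp hFc)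
      fun v => posSemidef_condOp (hFp v) hσ).continuousOn 1
    (c := Fintype.card b) (by exact_mod_cast Fintype.card_pos)
  convert h using 1
  ext e
  constructor
  · rintro ⟨N, P, rfl⟩
    have hex : ∀ k, ∃ v : b × b → ℂ, star v ⬝ᵥ v = 1 ∧
        P.effect k = ((P.effect k).trace.re : ℂ) • F v := by
      intro k
      have hP := P.posSemidef k
      rcases eq_or_ne (P.effect k).trace.re 0 with h0 | h0
      · refine ⟨Pi.single (Classical.arbitrary _) 1, by simp, ?_⟩
        rw [h0, eq_zero_of_trace_re_eq_zero hP h0]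
        simp
      · set t := (P.effect k).trace.re
        have ht : 0 ≤ t := (Complex.le_def.1 hP.trace_nonneg).1
        have htc : (t : ℂ) ≠ 0 := by exact_mod_cast h0
        have htr : (P.effect k).trace = (t : ℂ) :=
          Complex.ext rfl (Complex.le_def.1 hP.trace_nonneg).2.symm
        obtain ⟨v, hv⟩ := exists_eq_conjTranspose_mul_uncurry
          (hP.smul (a := (t : ℂ)⁻¹) (by
            rw [← Complex.ofReal_inv]; exact_mod_cast inv_nonneg.2 ht))
        refine ⟨v, ?_, ?_⟩
        · rw [← trace_conjTranspose_mul_uncurry, ← hv, trace_smul, htr, smul_eq_mul,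
            inv_mul_cancel₀ htc]
        · change _ = (t : ℂ) • ((of fun i j => v (i, j))ᴴ * of fun i j => v (i, j))
          rw [← hv, smul_smul, mul_inv_cancel₀ htc, one_smul]
    choose v hv hPv using hex
    refine ⟨N, fun k => (P.effect k).trace.re, v,
      fun k => (Complex.le_def.1 (P.posSemidef k).trace_nonneg).1, hv, ?_, ?_, ?_⟩
    · rw [← Complex.re_sum, ← trace_sum, P.sum_eq_one, trace_one]
      simp
    · rw [← P.sum_eq_one]
      refine Finset.sum_congr rfl fun k _ => ?_
      conv_rhs => rw [hPv k]
      exact (Complex.coe_smul _ _).symm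
    · refine Finset.sum_congr rfl fun k _ => ?_
      conv_lhs => rw [hPv k]
      rw [condOp_smul_left, scaledEntropy_smul]
  · rintro ⟨N, t, v, ht, -, -, hsum, rfl⟩
    refine ⟨N, ⟨fun k => (t k : ℂ) • F (v k), fun k => ?_, ?_⟩, ?_⟩
    · exact (hFp _).smul (by exact_mod_cast ht k)
    · rw [← hsum]
      exact Finset.sum_congr rfl fun k _ => Complex.coe_smul _ _
    · refine Finset.sum_congr rfl fun k _ => ?_
      rw [condOp_smul_left, scaledEntropy_smul]

end measurement

/-! ### The thermal purification and its marginal -/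

theorem traceRight_kronecker_one_mul {m n : Type*} [Fintype m] [Fintype n] [DecidableEq n]
    (A : Matrix m m ℂ) (X : Matrix (m × n) (m × n) ℂ) :
    traceRight ((A ⊗ₖ (1 : Matrix n n ℂ)) * X) = A * traceRight X := by
  ext i j
  simp only [traceRight, of_apply, mul_apply, Fintype.sum_prod_type, kroneckerMap_apply, one_apply,
    mul_ite, mul_one, mul_zero, ite_mul, zero_mul, Finset.sum_ite_eq, Finset.mem_univ, if_true,
    Finset.mul_sum]
  exact Finset.sum_comm

theorem traceRight_mul_kronecker_one {m n : Type*} [Fintype m] [Fintype n] [DecidableEq n]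
    (A : Matrix m m ℂ) (X : Matrix (m × n) (m × n) ℂ) :
    traceRight (X * (A ⊗ₖ (1 : Matrix n n ℂ))) = traceRight X * A := by
  ext i j
  simp only [traceRight, of_apply, mul_apply, Fintype.sum_prod_type, kroneckerMap_apply, one_apply,
    mul_ite, mul_one, mul_zero, Finset.sum_ite_eq', Finset.mem_univ, if_true, Finset.sum_mul]
  exact Finset.sum_comm

namespace Hamiltonian

variable {n : Type*} [Fintype n]

theorem partition_pos [Nonempty n] (H : Hamiltonian n) (β : ℝ) : 0 < H.partition β :=
  Finset.sum_pos (fun _ _ => Real.exp_pos _) Finset.univ_nonempty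

theorem sum_eigenket_mul_star [DecidableEq n] (H : Hamiltonian n) (k l : n) :
    ∑ i, H.eigenket k i * star (H.eigenket l i) = if k = l then 1 else 0 := by
  have h := orthonormal_iff_ite.1 H.eigenbasis.orthonormal l k
  rw [PiLp.inner_apply] at h
  simpa [eigenket, eq_comm] using h

/-- Summing over the coordinates of `R` produces `⟨E_l|E_k⟩`, which removes the cross terms. -/
theorem traceRight_ketbra_thermalPurification (H : Hamiltonian n) (β : ℝ) :
    traceRight (ketbra (H.thermalPurification β)) = H.thermalState β := by
  classical
  have hZ : ((Real.sqrt (H.partition β) : ℂ))⁻¹ * ((Real.sqrt (H.partition β) : ℂ))⁻¹ =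
      ((H.partition β : ℂ))⁻¹ := by
    rw [← mul_inv, ← Complex.ofReal_mul,
      Real.mul_self_sqrt (show 0 ≤ H.partition β from
        Finset.sum_nonneg fun _ _ => (Real.exp_pos _).le)]
  have hexp : ∀ k, (Real.exp (-β * H.energy k / 2) : ℂ) * (Real.exp (-β * H.energy k / 2) : ℂ) =
      (Real.exp (-β * H.energy k) : ℂ) := by
    intro k
    rw [← Complex.ofReal_mul, ← Real.exp_add, add_halves]
  ext i j
  set c : n → ℂ := fun k => (Real.exp (-β * H.energy k / 2) : ℂ)
  have hcstar : ∀ k, star (c k) = c k := fun k => Complex.conj_ofReal _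
  set z : ℂ := ((Real.sqrt (H.partition β) : ℂ))⁻¹
  have hzstar : star z = z := by
    simp only [z, star_inv₀, RCLike.star_def, Complex.conj_ofReal]
  calc traceRight (ketbra (H.thermalPurification β)) i j
      = ∑ x, (z * ∑ k, c k * (H.eigenket k i * H.eigenket k x)) *
          star (z * ∑ l, c l * (H.eigenket l j * H.eigenket l x)) := rfl
    _ = (z * z) * ∑ k, ∑ l, c k * c l * H.eigenket k i * star (H.eigenket l j) *
          ∑ x, H.eigenket k x * star (H.eigenket l x) := by
        have hx : ∀ x, (z * ∑ k, c k * (H.eigenket k i * H.eigenket k x)) *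
            star (z * ∑ l, c l * (H.eigenket l j * H.eigenket l x)) =
            ∑ k, ∑ l, (z * z) * (c k * c l * H.eigenket k i * star (H.eigenket l j) *
              (H.eigenket k x * star (H.eigenket l x))) := by
          intro x
          rw [star_mul', star_sum, hzstar, mul_mul_mul_comm, Finset.sum_mul_sum, Finset.mul_sum]
          refine Finset.sum_congr rfl fun k _ => ?_
          rw [Finset.mul_sum]
          refine Finset.sum_congr rfl fun l _ => ?_
          rw [star_mul', star_mul', hcstar]
          ring
        rw [Finset.sum_congr rfl fun x _ => hx x]
        simp only [Finset.mul_sum]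
        rw [Finset.sum_comm]
        exact Finset.sum_congr rfl fun k _ => Finset.sum_comm
    _ = H.thermalState β i j := by
        simp only [sum_eigenket_mul_star, mul_ite, mul_one, mul_zero, Finset.sum_ite_eq,
          Finset.mem_univ, if_true, thermalState, Matrix.smul_apply, Matrix.sum_apply, ketbra,
          vecMulVec_apply, Pi.star_apply, smul_eq_mul]
        rw [show z * z = _ from hZ]
        congr 1
        refine Finset.sum_congr rfl fun k _ => ?_
        rw [show c k * c k = _ from hexp k, mul_assoc]

theorem trace_thermalState [Nonempty n] (H : Hamiltonian n) (β : ℝ) :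
    (H.thermalState β).trace = 1 := by
  classical
  have hket : ∀ k, (ketbra (H.eigenket k)).trace = 1 := by
    intro k
    rw [trace_ketbra, dotProduct_comm]
    simpa [dotProduct] using H.sum_eigenket_mul_star k k
  rw [thermalState, trace_smul, trace_sum]
  simp only [trace_smul, hket, smul_eq_mul, mul_one]
  rw [← Complex.ofReal_sum]
  exact inv_mul_cancel₀ (by exact_mod_cast (H.partition_pos β).ne')

end Hamiltonian

/-! ### The joint state and the charge of a thermal operation -/

namespace ThermalOperation

variable {s b : Type*} [Fintype s] [DecidableEq s] [Fintype b] [DecidableEq b]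
  (T : ThermalOperation s b)

theorem posSemidef_jointState {ρ : Matrix s s ℂ} (hρ : ρ.PosSemidef) :
    (T.jointState ρ).PosSemidef :=
  ((hρ.kronecker (posSemidef_ketbra _)).submatrix _).mul_mul_conjTranspose_same _

theorem traceRight_jointState (ρ : Matrix s s ℂ) :
    traceRight (T.jointState ρ) = T.U * (ρ ⊗ₖ T.Hb.thermalState T.β) * T.Uᴴ := by
  set X := (ρ ⊗ₖ ketbra (T.Hb.thermalPurification T.β)).submatrix
      (Equiv.prodAssoc s b b) (Equiv.prodAssoc s b b) with hX
  have hlocal : traceRight (T.jointState ρ) = T.U * traceRight X * T.Uᴴ := by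
    rw [jointState, conjTranspose_kronecker, conjTranspose_one, traceRight_mul_kronecker_one,
      traceRight_kronecker_one_mul]
  rw [hlocal]
  congr 2
  ext i j
  rw [← T.Hb.traceRight_ketbra_thermalPurification T.β]
  simp [hX, traceRight, kroneckerMap_apply, Finset.mul_sum]

theorem apply_eq (ρ : Matrix s s ℂ) : T.apply ρ = traceRight (traceRight (T.jointState ρ)) := by
  rw [traceRight_jointState, apply]

theorem trace_jointState [Nonempty b] {ρ : Matrix s s ℂ} (hρ : ρ.trace = 1) :
    (T.jointState ρ).trace = 1 := by
  rw [← trace_traceRight, traceRight_jointState, trace_mul_comm, ← mul_assoc,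
    show T.Uᴴ * T.U = 1 from mem_unitaryGroup_iff'.1 T.unitary, one_mul, trace_kronecker, hρ,
    T.Hb.trace_thermalState, one_mul]

theorem exists_jointState_eq_ketbra {ρ : Matrix s s ℂ} (hρ : IsPure ρ) :
    ∃ Ψ, T.jointState ρ = ketbra Ψ := by
  obtain ⟨ψ, -, rfl⟩ := hρ
  set W := T.U ⊗ₖ (1 : Matrix b b ℂ)
  set u : (s × b) × b → ℂ := fun x => ψ x.1.1 * T.Hb.thermalPurification T.β (x.1.2, x.2)
  have hu : (ketbra ψ ⊗ₖ ketbra (T.Hb.thermalPurification T.β)).submatrix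
      (Equiv.prodAssoc s b b) (Equiv.prodAssoc s b b) = ketbra u := by
    ext x y
    simp [ketbra, vecMulVec_apply, u]
    ring
  refine ⟨W *ᵥ u, ?_⟩
  rw [jointState, hu, ketbra, ketbra, mul_vecMulVec, vecMulVec_mul, star_mulVec]

/-- The effects sum to `1`, so the energies add up to that of the unconditioned state; only the
entropy depends on the measurement. -/
theorem charge_eq {ρ : Matrix s s ℂ} (hρ : ρ.PosSemidef) {N : ℕ} (P : POVM N b) :
    T.charge ρ P = (T.apply ρ * T.Hs.op).trace.re -
      1 / T.β * measuredEntropy (T.jointState ρ) P := by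
  set σ := T.jointState ρ
  have hterm : ∀ k, T.outcomeProb ρ P k * freeEnergy T.β T.Hs.op (T.postState ρ P k) =
      (T.Hs.op * condOp (P.effect k) σ).trace.re -
        1 / T.β * scaledEntropy (condOp (P.effect k) σ) := by
    intro k
    have hp : T.outcomeProb ρ P k = (condOp (P.effect k) σ).trace.re := by
      rw [condOp, trace_traceRight]
      rfl
    have hpost : T.postState ρ P k =
        ((condOp (P.effect k) σ).trace.re : ℂ)⁻¹ • condOp (P.effect k) σ := by
      rw [← hp]
      rfl
    rw [hpost, hp, scaledEntropy]
    -- An outcome of probability zero has a positive semidefinite conditional operator of trace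
    -- zero, so it vanishes on both sides.
    rcases eq_or_ne (condOp (P.effect k) σ).trace.re 0 with h | h
    · rw [eq_zero_of_trace_re_eq_zero
        (posSemidef_condOp (P.posSemidef k) (T.posSemidef_jointState hρ)) h]
      simp
    · rw [freeEnergy, Matrix.mul_smul, trace_smul, ← Complex.ofReal_inv, smul_eq_mul,
        Complex.re_ofReal_mul, mul_sub, mul_inv_cancel_left₀ h]
      ring
  rw [charge, Finset.sum_congr rfl fun k _ => hterm k, Finset.sum_sub_distrib, ← Finset.mul_sum,
    ← Complex.re_sum, ← trace_sum, ← Finset.mul_sum, ← condOp_sum_left, P.sum_eq_one, condOp_one,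
    ← apply_eq, trace_mul_comm]
  rfl

theorem isCompact_weakCharges [Nonempty b] {ρ : Matrix s s ℂ} (hρ : ρ.PosSemidef) :
    IsCompact (T.weakCharges ρ) := by
  have h : T.weakCharges ρ = (fun v => (T.apply ρ * T.Hs.op).trace.re - 1 / T.β * v) ''
      {v : ℝ | ∃ (N : ℕ) (P : POVM N b), v = measuredEntropy (T.jointState ρ) P} := by
    ext w
    constructor
    · rintro ⟨N, P, rfl⟩
      exact ⟨_, ⟨N, P, rfl⟩, (T.charge_eq hρ P).symm⟩
    · rintro ⟨_, ⟨N, P, rfl⟩, rfl⟩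
      exact ⟨N, P, (T.charge_eq hρ P).symm⟩
  rw [h]
  exact (isCompact_measuredEntropies (T.posSemidef_jointState hρ)).image (by fun_prop)

end ThermalOperation

/-- The measurement with a single, certain outcome. -/
def POVM.trivial (b : Type*) [Fintype b] [DecidableEq b] : POVM 1 b where
  effect _ := 1
  posSemidef _ := PosSemidef.one
  sum_eq_one := by simp

end QBattery

end

theorem theorem1 {s b : Type*} [Fintype s] [DecidableEq s] [Fintype b] [DecidableEq b] [Nonempty b]
    (T : QBattery.ThermalOperation s b) (ρ : Matrix s s ℂ) (hρ : QBattery.IsDensity ρ) :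
    -- the maximum and the minimum that define the two quantities are attained
    IsGreatest (T.weakCharges ρ) (T.weakCharge ρ) ∧
    IsLeast (QBattery.ensembleEntanglements (T.systemReference ρ))
      (QBattery.entanglementOfFormation (T.systemReference ρ)) ∧
    -- the bound
    T.weakCharge ρ ≤ (T.apply ρ * T.Hs.op).trace.re
      - 1 / T.β * QBattery.entanglementOfFormation (T.systemReference ρ) ∧
    -- equality for pure battery states
    (QBattery.IsPure ρ →
      T.weakCharge ρ = (T.apply ρ * T.Hs.op).trace.re
        - 1 / T.β * QBattery.entanglementOfFormation (T.systemReference ρ)) := by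
  have hβ : 0 ≤ 1 / T.β := one_div_nonneg.2 T.β_pos.le
  have hbound : ∀ {N : ℕ} (P : QBattery.POVM N b),
      ∃ e ∈ QBattery.ensembleEntanglements (T.systemReference ρ),
        e ≤ QBattery.measuredEntropy (T.jointState ρ) P := fun P =>
    QBattery.exists_ensembleEntanglement_le_measuredEntropy (T.posSemidef_jointState hρ.1)
      (T.trace_jointState hρ.2) P
  have hmax : IsGreatest (T.weakCharges ρ) (T.weakCharge ρ) :=
    (T.isCompact_weakCharges hρ.1).isGreatest_sSup ⟨_, 1, QBattery.POVM.trivial b, rfl⟩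
  have hmin : IsLeast (QBattery.ensembleEntanglements (T.systemReference ρ))
      (QBattery.entanglementOfFormation (T.systemReference ρ)) := by
    -- The trivial measurement supplies a decomposition, so the infimum is over a nonempty compact
    -- set.
    obtain ⟨e, he, -⟩ := hbound (QBattery.POVM.trivial b)
    exact (QBattery.isCompact_ensembleEntanglements _).isLeast_sInf ⟨e, he⟩
  have hle : T.weakCharge ρ ≤ (T.apply ρ * T.Hs.op).trace.re
      - 1 / T.β * QBattery.entanglementOfFormation (T.systemReference ρ) := by
    obtain ⟨N, P, hP⟩ := hmax.1
    obtain ⟨e, he, heP⟩ := hbound P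
    rw [hP, T.charge_eq hρ.1]
    exact sub_le_sub_left (mul_le_mul_of_nonneg_left ((hmin.2 he).trans heP) hβ) _
  refine ⟨hmax, hmin, hle, fun hpure => le_antisymm hle ?_⟩
  obtain ⟨Ψ, hΨ⟩ := T.exists_jointState_eq_ketbra hpure
  have hmem := hmin.1
  rw [show T.systemReference ρ = QBattery.traceMiddle (T.jointState ρ) from rfl, hΨ] at hmem
  obtain ⟨N, P, hP⟩ := QBattery.exists_povm_measuredEntropy_of_mem Ψ hmem
  refine hmax.2 ⟨N, P, ?_⟩
  rw [T.charge_eq hρ.1, hΨ, hP, ← hΨ]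
  rfl
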